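/- For an ordinal $\beta$ let $\mathcal C(\beta)$ be the Banach space of continuous real-valued functions on the compact ordinal interval $[0,\beta]$ (order topology), with the supremum norm. For compact Hausdorff spaces $K,L$ let $d_{BM}(\mathcal C(K),\mathcal C(L))\in[0,\infty]$ be the infimum of $\|T\|\cdot\|T^{-1}\|$ over all surjective linear isomorphisms $T:\mathcal C(K)\to\mathcal C(L)$, and let $d_{BM}^+(\mathcal C(K),\mathcal C(L))\in[0,\infty]$ be the infimum of $\|T\|\cdot\|T^{-1}\|$ over those surjective linear isomorphisms $T:\mathcal C(K)\to\mathcal C(L)$ that are positive, i.e. $Tf\ge 0$ whenever $f\ge 0$ (no positivity of $T^{-1}$ is required); the infimum of the empty set is $\infty$. Let $\alpha$ be an ordinal and $n\ge 1$ an integer. Then $$2n-1\le d_{BM}^+(\mathcal C(\omega^\alpha\cdot n),\mathcal C(\omega^\alpha)).$$ If moreover $\alpha$ is countable and nonzero, then $$d_{BM}^+(\mathcal C(\omega^\alpha\cdot n),\mathcal C(\omega^\alpha))\le n+\sqrt{(n-1)(n+3)}$$ and $$d_{BM}(\mathcal C(\omega^\alpha),\mathcal C(\omega^\alpha\cdot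 n))\le d_{BM}^+(\mathcal C(\omega^\alpha),\mathcal C(\omega^\alpha\cdot n))\le 2+\sqrt5 .$$ -/

import Mathlib

open scoped ENNReal

/-- `C(K)`-isomorphism `T` is positive, `T ≥ 0`: it maps nonnegative functions to nonnegative
functions. Nothing is assumed on the inverse of `T`. -/
def IsPositiveIso {K L : Type*} [TopologicalSpace K] [CompactSpace K]
    [TopologicalSpace L] [CompactSpace L] (T : C(K, ℝ) ≃L[ℝ] C(L, ℝ)) : Prop :=
  ∀ f : C(K, ℝ), 0 ≤ f → 0 ≤ T f

/-- The number `‖T‖ * ‖T⁻¹‖` (operator norms for the supremum norms on `C(K)` and `C(L)`),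
as an extended nonnegative real. -/
noncomputable def distortion {K L : Type*} [TopologicalSpace K] [CompactSpace K]
    [TopologicalSpace L] [CompactSpace L] (T : C(K, ℝ) ≃L[ℝ] C(L, ℝ)) : ℝ≥0∞ :=
  ENNReal.ofReal (‖(T : C(K, ℝ) →L[ℝ] C(L, ℝ))‖ * ‖(T.symm : C(L, ℝ) →L[ℝ] C(K, ℝ))‖)

/-- The Banach-Mazur distance `d_BM(C(K), C(L))`: the infimum of `‖T‖ * ‖T⁻¹‖` over all
surjective isomorphisms `T : C(K) → C(L)`; it is `∞` if there are none. -/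
noncomputable def banachMazurDist (K L : Type*) [TopologicalSpace K] [CompactSpace K]
    [TopologicalSpace L] [CompactSpace L] : ℝ≥0∞ :=
  ⨅ T : C(K, ℝ) ≃L[ℝ] C(L, ℝ), distortion T

/-- The one-sided positive Banach-Mazur distance `d_BM^+(C(K), C(L))`: the infimum of
`‖T‖ * ‖T⁻¹‖` over all surjective isomorphisms `T : C(K) → C(L)` with `T ≥ 0`; it is `∞` if
there are none. -/
noncomputable def positiveBanachMazurDist (K L : Type*) [TopologicalSpace K] [CompactSpace K]
    [TopologicalSpace L] [CompactSpace L] : ℝ≥0∞ :=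
  ⨅ (T : C(K, ℝ) ≃L[ℝ] C(L, ℝ)) (_ : IsPositiveIso T), distortion T

/-- The compact ordinal interval `[0, o]` (with the order topology). -/
abbrev OrdinalInterval (o : Ordinal) : Type _ := Set.Icc (0 : Ordinal) o

/-!
The lower bound. Let `T ≥ 0` be an isomorphism from `C(ω ^ α * n)` onto `C(ω ^ α)`, `h = T⁻¹ 1`,
and let `m i` be the mass that the positive functional `f ↦ T f (ω ^ α)` gives to a small
neighbourhood `U i` of `x i = ω ^ α * (i + 1)`. If `g` is the indicator of an interval inside
`U i`, then `T g` is at most about `m i` close to the point `ω ^ α`. Away from it, that is on some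
`[0, β]` with `β < ω ^ α`, `T g` can be made small by choosing the interval well, because `[0, β]`
has smaller Cantor–Bendixson height than `U i` (`exists_iocIndicator_lt`). Here the points of
height at least `γ > 0` are the nonzero multiples of `ω ^ γ`, and the proof is a transfinite induction
on `γ`: infinitely many disjoint intervals cannot all have a large image at one point, so the
points where their images are large accumulate. Hence `2 / m i * g - h` is mapped into the unit
ball, up to an error that tends to `0`, which gives `2 ≤ (‖T⁻¹‖ + h (x i)) * m i`
(`two_le_mul_add`). Adding up over `i` and using
`T h (ω ^ α) = 1`, `T 1 (ω ^ α) ≤ ‖T‖` and `‖h‖ ≤ ‖T⁻¹‖` yields `2 * n ≤ ‖T‖ * ‖T⁻¹‖ + 1`. For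
`α = 0` the spaces have different finite dimensions unless `n = 1`.

The upper bounds. Let `Y = [0, ω ^ α]` with `α` countable and nonzero, and `n = m + 1`. Then
`[0, ω ^ α * n]` is a disjoint union of `n` copies of `Y`, and `Y` absorbs `m` isolated points.
Moreover `Y` is a wedge sum of `n` copies of itself at its last point
(`nonempty_wedgeDecomposition`): if `γ` enumerates the countably many ordinals below `ω ^ α`,
then `Y` is the one-point compactification of the disjoint union of the intervals `[0, γ k]`, and
equally of `n` copies of that union. So there is a positive map from `C(ω ^ α * n)` to `C(ω ^ α)`
that adds up, with suitable weights, the `n` given functions on the summands of the wedge, and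
records the values of `m` of them at the last point of `Y` in the isolated points (`wedgeSum`). In
the opposite direction, each of `m` summands is averaged with the value at an isolated point
(`wedgeSplit`). Both maps have explicit inverses, and the weights balance the resulting estimates.
-/

/-! ### Banach–Mazur distances -/

lemma banachMazurDist_le_positiveBanachMazurDist (K L : Type*) [TopologicalSpace K]
    [CompactSpace K] [TopologicalSpace L] [CompactSpace L] :
    banachMazurDist K L ≤ positiveBanachMazurDist K L :=
  le_iInf fun T => le_iInf fun _ => iInf_le _ T

section
variable {K L K' L' : Type*} [TopologicalSpace K] [CompactSpace K] [TopologicalSpace L]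
  [CompactSpace L] [TopologicalSpace K'] [CompactSpace K'] [TopologicalSpace L'] [CompactSpace L']

/-- A positive linear map with `T 1 ≤ 1` is a contraction, so a positive bijection `T` with
`T 1 ≤ 1` and inverse bounded by `c` witnesses `d_BM^+ ≤ c`. -/
lemma positiveBanachMazurDist_le (T : C(K, ℝ) →ₗ[ℝ] C(L, ℝ)) (S : C(L, ℝ) →ₗ[ℝ] C(K, ℝ))
    (hST : ∀ f, S (T f) = f) (hTS : ∀ g, T (S g) = g) (hpos : ∀ f, 0 ≤ f → 0 ≤ T f)
    (h1 : T 1 ≤ 1) {c : ℝ} (hc : 0 ≤ c) (hS : ∀ g, ‖S g‖ ≤ c * ‖g‖) :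
    positiveBanachMazurDist K L ≤ ENNReal.ofReal c := by
  have hT : ∀ f, ‖T f‖ ≤ 1 * ‖f‖ := by
    intro f
    rw [one_mul, ContinuousMap.norm_le _ (norm_nonneg _)]
    intro y
    have h1y : T 1 y ≤ 1 := h1 y
    have up : 0 ≤ T (‖f‖ • (1 : C(K, ℝ)) - f) y := hpos _ (fun x => by
      have := f.norm_coe_le_norm x
      change 0 ≤ ‖f‖ * 1 - f x
      linarith [le_abs_self (f x), Real.norm_eq_abs (f x)]) y
    have lo : 0 ≤ T (‖f‖ • (1 : C(K, ℝ)) + f) y := hpos _ (fun x => by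
      have := f.norm_coe_le_norm x
      change 0 ≤ ‖f‖ * 1 + f x
      linarith [neg_abs_le (f x), Real.norm_eq_abs (f x)]) y
    rw [map_sub, map_smul] at up
    rw [map_add, map_smul] at lo
    simp only [ContinuousMap.sub_apply, ContinuousMap.add_apply, ContinuousMap.smul_apply,
        smul_eq_mul] at up lo
    have := mul_le_mul_of_nonneg_left h1y (norm_nonneg f)
    rw [Real.norm_eq_abs, abs_le]
    constructor <;> linarith
  let E : C(K, ℝ) ≃ₗ[ℝ] C(L, ℝ) := LinearEquiv.ofLinearMap T S (LinearMap.ext hTS)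
    (LinearMap.ext hST)
  let E' : C(K, ℝ) ≃L[ℝ] C(L, ℝ) :=
    { E with
      continuous_toFun := (T.mkContinuous 1 hT).continuous
      continuous_invFun := (S.mkContinuous c hS).continuous }
  have hn : ‖(E' : C(K, ℝ) →L[ℝ] C(L, ℝ))‖ * ‖(E'.symm : C(L, ℝ) →L[ℝ] C(K, ℝ))‖ ≤ 1 * c := by
    refine mul_le_mul ?_ ?_ (by positivity) zero_le_one
    · exact ContinuousLinearMap.opNorm_le_bound _ zero_le_one hT
    · exact ContinuousLinearMap.opNorm_le_bound _ hc hS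
  rw [one_mul] at hn
  exact (iInf₂_le E' hpos).trans (ENNReal.ofReal_le_ofReal hn)

/-- The isometric isomorphism of spaces of continuous functions induced by a homeomorphism. -/
noncomputable def Homeomorph.continuousMapIsometry (e : K ≃ₜ K') : C(K, ℝ) ≃ₗᵢ[ℝ] C(K', ℝ) where
  toFun f := f.comp (e.symm : C(K', K))
  invFun g := g.comp (e : C(K, K'))
  left_inv f := by ext; simp
  right_inv f := by ext; simp
  map_add' _ _ := rfl
  map_smul' _ _ := rfl
  norm_map' f := by
    change ‖f.comp (e.symm : C(K', K))‖ = ‖f‖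
    refine le_antisymm ?_ ?_ <;> rw [ContinuousMap.norm_le _ (norm_nonneg _)] <;> intro x
    · exact f.norm_coe_le_norm _
    · simpa using (f.comp (e.symm : C(K', K))).norm_coe_le_norm (e x)

lemma Homeomorph.continuousMapIsometry_nonneg (e : K ≃ₜ K') {f : C(K, ℝ)} (hf : 0 ≤ f) :
    0 ≤ e.continuousMapIsometry f := fun x => hf (e.symm x)

lemma positiveBanachMazurDist_le_of_homeomorph (e : K ≃ₜ K') (e' : L ≃ₜ L') :
    positiveBanachMazurDist K L ≤ positiveBanachMazurDist K' L' := by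
  refine le_iInf₂ fun T hT => ?_
  let E := e.continuousMapIsometry
  let F := e'.symm.continuousMapIsometry
  let T' : C(K, ℝ) ≃L[ℝ] C(L, ℝ) :=
    (E.toContinuousLinearEquiv.trans T).trans F.toContinuousLinearEquiv
  refine (iInf₂_le T' fun f hf => ?_).trans (ENNReal.ofReal_le_ofReal ?_)
  · exact e'.symm.continuousMapIsometry_nonneg (hT _ (e.continuousMapIsometry_nonneg hf))
  · refine mul_le_mul ?_ ?_ (by positivity) (by positivity)
    · refine ContinuousLinearMap.opNorm_le_bound _ (by positivity) fun f => ?_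
      change ‖F (T (E f))‖ ≤ _
      rw [F.norm_map, ← E.norm_map f]
      exact (T : C(K', ℝ) →L[ℝ] C(L', ℝ)).le_opNorm _
    · refine ContinuousLinearMap.opNorm_le_bound _ (by positivity) fun f => ?_
      change ‖E.symm (T.symm (F.symm f))‖ ≤ _
      rw [E.symm.norm_map, ← F.symm.norm_map f]
      exact (T.symm : C(L', ℝ) →L[ℝ] C(K', ℝ)).le_opNorm _

end

lemma positiveBanachMazurDist_self_le (K : Type*) [TopologicalSpace K] [CompactSpace K] :
    positiveBanachMazurDist K K ≤ 1 := by
  have := positiveBanachMazurDist_le (K := K) (L := K) LinearMap.id LinearMap.id (fun _ => rfl)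
    (fun _ => rfl) (fun _ h => h) le_rfl zero_le_one (fun g => by simp)
  simpa using this

/-! ### Positive isomorphisms from self-similarity -/

/-- `Y` is a wedge sum, at the point `b`, of copies of itself indexed by `ι`: `emb i` is the
inclusion of the `i`-th copy and `proj i` collapses all the other copies to `b`. -/
structure WedgeDecomposition (ι Y : Type*) [TopologicalSpace Y] (b : Y) where
  emb : ι → C(Y, Y)
  proj : ι → C(Y, Y)
  proj_emb : ∀ i y, proj i (emb i y) = y
  proj_emb_of_ne : ∀ i j y, i ≠ j → proj i (emb j y) = b
  emb_base : ∀ i, emb i b = b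
  exists_emb : ∀ l, ∃ i y, emb i y = l

section
variable {J Y : Type*} [Fintype J] [TopologicalSpace J] [DiscreteTopology J] [TopologicalSpace Y]
  {b : Y}

lemma WedgeDecomposition.proj_base {ι : Type*} (W : WedgeDecomposition ι Y b) (i : ι) :
    W.proj i b = b := by
  have h := W.proj_emb i b
  rwa [W.emb_base] at h

/-- `C((J × Y) ⊕ Y) → C(J ⊕ Y)`: on the wedge `Y` the summands of `f` are added up with weight
`u` for the copies in `J × Y` and `v` for the last copy; the base point values of the copies in
`J × Y` are stored in `J`. -/
noncomputable def wedgeSum (W : WedgeDecomposition (Option J) Y b) (u v : ℝ) :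
    C((J × Y) ⊕ Y, ℝ) →ₗ[ℝ] C(J ⊕ Y, ℝ) where
  toFun f := ⟨Sum.elim (fun j => f (.inl (j, b)))
      (fun l => u * ∑ j, f (.inl (j, W.proj (some j) l)) + v * f (.inr (W.proj none l))), by
    refine continuous_sumElim.2 ⟨continuous_of_discreteTopology, by fun_prop⟩⟩
  map_add' f g := by
    ext (j | l)
    · simp
    · simp [Finset.sum_add_distrib]; ring
  map_smul' c f := by
    ext (j | l)
    · simp
    · simp [← Finset.mul_sum]; ring

/-- The inverse of `wedgeSum`. -/
noncomputable def wedgeSumInv (W : WedgeDecomposition (Option J) Y b) (u v : ℝ) :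
    C(J ⊕ Y, ℝ) →ₗ[ℝ] C((J × Y) ⊕ Y, ℝ) where
  toFun g := ⟨Sum.elim
      (fun p => g (.inl p.1) + (g (.inr (W.emb (some p.1) p.2)) - g (.inr b)) / u)
      (fun y => (g (.inr (W.emb none y)) - u * ∑ j, g (.inl j)) / v), by
    refine continuous_sumElim.2 ⟨?_, by fun_prop⟩
    rw [continuous_prod_of_discrete_left]
    intro j
    dsimp only
    fun_prop⟩
  map_add' f g := by
    ext (j | l)
    · simp; ring
    · simp [Finset.sum_add_distrib]; ring
  map_smul' c f := by
    ext (j | l)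
    · simp; ring
    · simp [← Finset.mul_sum]; ring

lemma wedgeSumInv_wedgeSum (W : WedgeDecomposition (Option J) Y b) {u v : ℝ} (hu : u ≠ 0)
    (hv : v ≠ 0) (f : C((J × Y) ⊕ Y, ℝ)) : wedgeSumInv W u v (wedgeSum W u v f) = f := by
  ext (⟨j, y⟩ | y)
  · have h : ∑ k, f (.inl (k, W.proj (some k) (W.emb (some j) y)))
        - ∑ k, f (.inl (k, b)) = f (.inl (j, y)) - f (.inl (j, b)) := by
      rw [← Finset.sum_sub_distrib, Finset.sum_eq_single j]
      · rw [W.proj_emb]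
      · intro k _ hk
        rw [W.proj_emb_of_ne _ _ _ (by simpa using hk), sub_self]
      · simp
    simp only [wedgeSumInv, wedgeSum, LinearMap.coe_mk, AddHom.coe_mk, ContinuousMap.coe_mk,
      Sum.elim_inl, Sum.elim_inr, W.proj_base]
    rw [W.proj_emb_of_ne none (some j) y (by simp), add_sub_add_right_eq_sub, ← mul_sub, h,
      mul_div_cancel_left₀ _ hu]
    ring
  · have h : ∀ k, W.proj (some k) (W.emb none y) = b := fun k =>
      W.proj_emb_of_ne _ _ _ (by simp)
    simp only [wedgeSumInv, wedgeSum, LinearMap.coe_mk, AddHom.coe_mk, ContinuousMap.coe_mk,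
      Sum.elim_inl, Sum.elim_inr, W.proj_emb, h]
    field_simp
    ring

lemma wedgeSum_wedgeSumInv (W : WedgeDecomposition (Option J) Y b) {u v : ℝ} (hu : u ≠ 0)
    (hv : v ≠ 0) (g : C(J ⊕ Y, ℝ)) : wedgeSum W u v (wedgeSumInv W u v g) = g := by
  ext (j | l)
  · simp [wedgeSumInv, wedgeSum, W.emb_base]
  · obtain ⟨_ | j, y, rfl⟩ := W.exists_emb l
    · have h : ∀ k, W.proj (some k) (W.emb none y) = b := fun k =>
        W.proj_emb_of_ne _ _ _ (by simp)
      simp only [wedgeSumInv, wedgeSum, LinearMap.coe_mk, AddHom.coe_mk, ContinuousMap.coe_mk,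
        Sum.elim_inl, Sum.elim_inr, W.proj_emb, h, W.emb_base, sub_self, zero_div, add_zero]
      field_simp
      ring
    · have h : ∑ k, (g (.inr (W.emb (some k) (W.proj (some k) (W.emb (some j) y)))) - g (.inr b)) / u
          = (g (.inr (W.emb (some j) y)) - g (.inr b)) / u := by
        rw [Finset.sum_eq_single j]
        · rw [W.proj_emb]
        · intro k _ hk
          rw [W.proj_emb_of_ne _ _ _ (by simpa using hk), W.emb_base, sub_self, zero_div]
        · simp
      simp only [wedgeSumInv, wedgeSum, LinearMap.coe_mk, AddHom.coe_mk, ContinuousMap.coe_mk,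
        Sum.elim_inl, Sum.elim_inr, Finset.sum_add_distrib, h]
      rw [W.proj_emb_of_ne none (some j) y (by simp), W.emb_base]
      field_simp
      ring

/-- `C(J ⊕ Y) → C((J × Y) ⊕ Y)`: the last copy of `Y` receives the last summand of the wedge `Y`
unchanged, the copy with index `j ∈ J` receives the `j`-th summand averaged, with weight `w`, with
the value at the isolated point `j`. -/
noncomputable def wedgeSplit (W : WedgeDecomposition (Option J) Y b) (w : ℝ) :
    C(J ⊕ Y, ℝ) →ₗ[ℝ] C((J × Y) ⊕ Y, ℝ) where
  toFun f := ⟨Sum.elim (fun p => w * f (.inr (W.emb (some p.1) p.2)) + (1 - w) * f (.inl p.1))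
      (fun y => f (.inr (W.emb none y))), by
    refine continuous_sumElim.2 ⟨?_, by fun_prop⟩
    rw [continuous_prod_of_discrete_left]
    intro j
    dsimp only
    fun_prop⟩
  map_add' f g := by
    ext (j | l)
    · simp; ring
    · simp
  map_smul' c f := by
    ext (j | l)
    · simp; ring
    · simp

/-- The inverse of `wedgeSplit`. -/
noncomputable def wedgeSplitInv (W : WedgeDecomposition (Option J) Y b) (w : ℝ) :
    C((J × Y) ⊕ Y, ℝ) →ₗ[ℝ] C(J ⊕ Y, ℝ) where
  -- On the `j`-th summand the value is `(g - g (j, b) + w * g b) / w`, on the last one it is `g`;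
  -- summing over all projections makes this a single formula on the wedge.
  toFun g := ⟨Sum.elim (fun j => (g (.inl (j, b)) - w * g (.inr b)) / (1 - w))
      (fun l => g (.inr (W.proj none l)) +
        (∑ j, (g (.inl (j, W.proj (some j) l)) - g (.inl (j, b)))) / w), by
    refine continuous_sumElim.2 ⟨continuous_of_discreteTopology, by fun_prop⟩⟩
  map_add' f g := by
    ext (j | l)
    · simp; ring
    · simp [Finset.sum_add_distrib]; ring
  map_smul' c f := by
    ext (j | l)
    · simp; ring
    · simp [← Finset.mul_sum, ← mul_sub]; ring

lemma wedgeSplitInv_emb_some (W : WedgeDecomposition (Option J) Y b) (w : ℝ)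
    (g : C((J × Y) ⊕ Y, ℝ)) (j : J) (y : Y) :
    wedgeSplitInv W w g (.inr (W.emb (some j) y)) =
      g (.inr b) + (g (.inl (j, y)) - g (.inl (j, b))) / w := by
  have h : ∑ k, (g (.inl (k, W.proj (some k) (W.emb (some j) y))) - g (.inl (k, b)))
      = g (.inl (j, y)) - g (.inl (j, b)) := by
    rw [Finset.sum_eq_single j]
    · rw [W.proj_emb]
    · intro k _ hk
      rw [W.proj_emb_of_ne _ _ _ (by simpa using hk), sub_self]
    · simp
  simp only [wedgeSplitInv, LinearMap.coe_mk, AddHom.coe_mk, ContinuousMap.coe_mk,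
    Sum.elim_inr, h]
  rw [W.proj_emb_of_ne none (some j) y (by simp)]

lemma wedgeSplitInv_emb_none (W : WedgeDecomposition (Option J) Y b) (w : ℝ)
    (g : C((J × Y) ⊕ Y, ℝ)) (y : Y) :
    wedgeSplitInv W w g (.inr (W.emb none y)) = g (.inr y) := by
  have h : ∀ k, W.proj (some k) (W.emb none y) = b := fun k => W.proj_emb_of_ne _ _ _ (by simp)
  simp [wedgeSplitInv, h, W.proj_emb]

lemma wedgeSplitInv_inl (W : WedgeDecomposition (Option J) Y b) (w : ℝ)
    (g : C((J × Y) ⊕ Y, ℝ)) (j : J) :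
    wedgeSplitInv W w g (.inl j) = (g (.inl (j, b)) - w * g (.inr b)) / (1 - w) := rfl

omit [Fintype J] in
lemma wedgeSplit_inl (W : WedgeDecomposition (Option J) Y b) (w : ℝ)
    (f : C(J ⊕ Y, ℝ)) (j : J) (y : Y) : wedgeSplit W w f (.inl (j, y)) =
      w * f (.inr (W.emb (some j) y)) + (1 - w) * f (.inl j) := rfl

omit [Fintype J] in
lemma wedgeSplit_inr (W : WedgeDecomposition (Option J) Y b) (w : ℝ)
    (f : C(J ⊕ Y, ℝ)) (y : Y) : wedgeSplit W w f (.inr y) = f (.inr (W.emb none y)) := rfl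

variable [CompactSpace Y]

lemma norm_wedgeSumInv_le (W : WedgeDecomposition (Option J) Y b) {u v c : ℝ} (hu : 0 < u)
    (hv : 0 < v) (hc : 0 ≤ c) (huc : 1 + 2 / u ≤ c) (hvc : (1 + Fintype.card J * u) / v ≤ c)
    (g : C(J ⊕ Y, ℝ)) : ‖wedgeSumInv W u v g‖ ≤ c * ‖g‖ := by
  rw [ContinuousMap.norm_le _ (by positivity)]
  have hg : ∀ x, |g x| ≤ ‖g‖ := g.norm_coe_le_norm
  rintro (⟨j, y⟩ | y)
  · simp only [wedgeSumInv, LinearMap.coe_mk, AddHom.coe_mk, ContinuousMap.coe_mk, Sum.elim_inl,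
      Real.norm_eq_abs]
    calc _ ≤ |g (.inl j)| + (|g (.inr (W.emb (some j) y))| + |g (.inr b)|) / u := by
          refine (abs_add_le _ _).trans (add_le_add le_rfl ?_)
          rw [abs_div, abs_of_pos hu]
          gcongr
          exact abs_sub _ _
      _ ≤ ‖g‖ + (‖g‖ + ‖g‖) / u := by gcongr <;> exact hg _
      _ = (1 + 2 / u) * ‖g‖ := by ring
      _ ≤ c * ‖g‖ := by gcongr
  · simp only [wedgeSumInv, LinearMap.coe_mk, AddHom.coe_mk, ContinuousMap.coe_mk, Sum.elim_inr,
      Real.norm_eq_abs]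
    calc _ ≤ (|g (.inr (W.emb none y))| + u * ∑ j, |g (.inl j)|) / v := by
          rw [abs_div, abs_of_pos hv]
          gcongr
          refine (abs_sub _ _).trans (add_le_add le_rfl ?_)
          rw [abs_mul, abs_of_pos hu]
          gcongr
          exact Finset.abs_sum_le_sum_abs _ _
      _ ≤ (‖g‖ + u * ∑ j : J, ‖g‖) / v := by gcongr <;> exact hg _
      _ = (1 + Fintype.card J * u) / v * ‖g‖ := by
          rw [Finset.sum_const, Finset.card_univ, nsmul_eq_mul]; ring
      _ ≤ c * ‖g‖ := by gcongr

/-- The weights `2 / (x - 1)` and `2 / (x + 1)`, with `x` the claimed bound, make all the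
estimates for the inverse equal to `x`. -/
lemma positiveBanachMazurDist_prod_sum_le (W : WedgeDecomposition (Option J) Y b) [Nonempty J] :
    positiveBanachMazurDist ((J × Y) ⊕ Y) (J ⊕ Y) ≤
      ENNReal.ofReal (((Fintype.card J : ℝ) + 1) +
        √((Fintype.card J : ℝ) * ((Fintype.card J : ℝ) + 4))) := by
  set m : ℝ := ((Fintype.card J : ℕ) : ℝ) with hm
  have hm1 : 1 ≤ m := by
    rw [hm]; exact_mod_cast Fintype.card_pos (α := J)
  set s := √(m * (m + 4)) with hs
  have hs2 : s * s = m * (m + 4) := Real.mul_self_sqrt (by positivity)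
  have hs0 : 0 ≤ s := Real.sqrt_nonneg _
  set x := m + 1 + s with hx
  have hx1 : 1 < x := by linarith
  have hx2 : x * x = 2 * (m + 1) * x + 2 * m - 1 := by
    rw [hx]; linear_combination hs2
  have hxm : x - 1 ≠ 0 := by linarith
  have hxp : x + 1 ≠ 0 := by linarith
  have hu : 0 < 2 / (x - 1) := div_pos two_pos (by linarith)
  have hv : 0 < 2 / (x + 1) := div_pos two_pos (by linarith)
  have huv : m * (2 / (x - 1)) + 2 / (x + 1) = 1 := by
    field_simp
    linear_combination -hx2
  refine positiveBanachMazurDist_le (wedgeSum W (2 / (x - 1)) (2 / (x + 1)))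
    (wedgeSumInv W (2 / (x - 1)) (2 / (x + 1))) (wedgeSumInv_wedgeSum W hu.ne' hv.ne')
    (wedgeSum_wedgeSumInv W hu.ne' hv.ne') ?_ ?_ (by linarith)
    (norm_wedgeSumInv_le W hu hv (by linarith) ?_ ?_)
  · rintro f hf (j | l)
    · exact hf _
    · exact add_nonneg (mul_nonneg hu.le (Finset.sum_nonneg fun j _ => hf _))
        (mul_nonneg hv.le (hf _))
  · rintro (j | l)
    · simp [wedgeSum]
    · change 2 / (x - 1) * ∑ _j : J, (1 : ℝ) + 2 / (x + 1) * 1 ≤ 1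
      rw [Finset.sum_const, Finset.card_univ, nsmul_eq_mul, ← hm]
      linarith
  · field_simp
    linarith
  · rw [div_le_iff₀ hv, ← hm]
    have : x * (2 / (x + 1)) = 2 - 2 / (x + 1) := by field_simp; ring
    linarith

/-- Here a single weight `w` balances the two estimates for the inverse, independently of `J`. -/
lemma positiveBanachMazurDist_sum_prod_le (W : WedgeDecomposition (Option J) Y b) :
    positiveBanachMazurDist (J ⊕ Y) ((J × Y) ⊕ Y) ≤ ENNReal.ofReal (2 + √5) := by
  have h5 : √5 * √5 = 5 := Real.mul_self_sqrt (by norm_num)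
  have h50 : 0 ≤ √5 := Real.sqrt_nonneg _
  -- the root of `w ^ 2 + w = 1`, for which `1 + 2 / w = (1 + w) / (1 - w) = 2 + √5`
  obtain ⟨w, hw⟩ : ∃ w : ℝ, w = (√5 - 1) / 2 := ⟨_, rfl⟩
  have hw0 : 0 < w := by rw [hw]; nlinarith
  have hw1 : 0 < 1 - w := by rw [hw]; nlinarith
  have hw0' := hw0.ne'
  have hw1' := hw1.ne'
  have e1 : 1 + 2 / w = 2 + √5 := by
    field_simp
    rw [hw]; linear_combination -h5 / 2
  have e2 : (1 + w) / (1 - w) = 2 + √5 := by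
    rw [div_eq_iff hw1', hw]; linear_combination h5 / 2
  refine positiveBanachMazurDist_le (wedgeSplit W w) (wedgeSplitInv W w) ?_ ?_ ?_ ?_
    (by linarith) ?_
  · intro f
    ext (j | l)
    · rw [wedgeSplitInv_inl, wedgeSplit_inl, wedgeSplit_inr, W.emb_base, W.emb_base]
      field_simp
      ring
    · obtain ⟨_ | j, y, rfl⟩ := W.exists_emb l
      · rw [wedgeSplitInv_emb_none, wedgeSplit_inr]
      · rw [wedgeSplitInv_emb_some, wedgeSplit_inl, wedgeSplit_inl, wedgeSplit_inr, W.emb_base,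
          W.emb_base]
        field_simp
        ring
  · intro g
    ext (⟨j, y⟩ | y)
    · rw [wedgeSplit_inl, wedgeSplitInv_emb_some, wedgeSplitInv_inl]
      field_simp
      ring
    · rw [wedgeSplit_inr, wedgeSplitInv_emb_none]
  · rintro f hf (⟨j, y⟩ | y)
    · exact add_nonneg (mul_nonneg hw0.le (hf _)) (mul_nonneg hw1.le (hf _))
    · exact hf _
  · rintro (⟨j, y⟩ | y)
    · simp [wedgeSplit_inl]
    · simp [wedgeSplit_inr]
  · intro g
    rw [ContinuousMap.norm_le _ (by positivity)]
    have hg : ∀ x, |g x| ≤ ‖g‖ := g.norm_coe_le_norm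
    rintro (j | l)
    · rw [wedgeSplitInv_inl, Real.norm_eq_abs, ← e2, abs_div, abs_of_pos hw1, div_mul_eq_mul_div]
      refine div_le_div_of_nonneg_right ?_ hw1.le
      calc _ ≤ |g (.inl (j, b))| + |w * g (.inr b)| := abs_sub _ _
        _ ≤ ‖g‖ + w * ‖g‖ := by
          rw [abs_mul, abs_of_pos hw0]; gcongr <;> exact hg _
        _ = _ := by ring
    · obtain ⟨_ | j, y, rfl⟩ := W.exists_emb l
      · rw [wedgeSplitInv_emb_none, Real.norm_eq_abs]
        refine (hg _).trans (le_mul_of_one_le_left (norm_nonneg _) (by linarith))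
      · rw [wedgeSplitInv_emb_some, Real.norm_eq_abs, ← e1]
        calc _ ≤ |g (.inr b)| + (|g (.inl (j, y))| + |g (.inl (j, b))|) / w := by
              refine (abs_add_le _ _).trans (add_le_add le_rfl ?_)
              rw [abs_div, abs_of_pos hw0]
              gcongr
              exact abs_sub _ _
          _ ≤ ‖g‖ + (‖g‖ + ‖g‖) / w := by gcongr <;> exact hg _
          _ = _ := by ring

end

/-! ### Multiples of powers of `ω` -/

section
open Ordinal Order Set

lemma isClosed_setOf_omega0_opow_dvd (γ : Ordinal) : IsClosed {y : Ordinal | ω ^ γ ∣ y} := by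
  rw [Ordinal.isClosed_iff_iSup]
  intro ι _ f hf
  choose z hz using hf
  have hpos : 0 < ω ^ γ := opow_pos γ omega0_pos
  refine ⟨⨆ i, z i, ?_⟩
  rw [(isNormal_mul_right hpos).map_iSup bddAbove_of_small]
  exact congrArg _ (funext hz)

lemma omega0_opow_dvd_of_isSuccLimit {γ y : Ordinal} (hγ : IsSuccLimit γ)
    (h : ∀ δ, 0 < δ → δ < γ → ω ^ δ ∣ y) : ω ^ γ ∣ y := by
  rw [dvd_iff_mod_eq_zero]
  by_contra h0
  obtain ⟨δ, hδ, hlt⟩ := (lt_opow_of_isSuccLimit omega0_ne_zero hγ).1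
    (mod_lt y (opow_ne_zero γ omega0_ne_zero))
  have hδ' : max δ 1 < γ := max_lt hδ (one_lt_of_isSuccLimit hγ)
  have hd := h (max δ 1) (lt_of_lt_of_le zero_lt_one (le_max_right _ _)) hδ'
  have h1 : ω ^ max δ 1 ∣ ω ^ γ * (y / ω ^ γ) :=
    (opow_dvd_opow _ hδ'.le).trans (dvd_mul_right _ _)
  rw [← div_add_mod y (ω ^ γ), dvd_add_iff h1] at hd
  exact (hlt.trans_le (opow_le_opow_right omega0_pos (le_max_left _ _))).not_ge (le_of_dvd h0 hd)

/-- The supremum is `ω ^ γ` times a limit ordinal, and limit ordinals are divisible by `ω`. -/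
lemma omega0_opow_add_one_dvd_iSup {γ : Ordinal} {y : ℕ → Ordinal} (hy : StrictMono y)
    (h : ∀ m, ω ^ γ ∣ y m) : ω ^ (γ + 1) ∣ ⨆ m, y m := by
  choose z hz using h
  have hpos : 0 < ω ^ γ := opow_pos γ omega0_pos
  have hzm : ∀ m, z m < z (m + 1) := fun m => by
    have := hy (Nat.lt_succ_self m)
    rw [hz, hz] at this
    exact (mul_lt_mul_iff_right₀ hpos).1 this
  have hsup : ⨆ m, y m = ω ^ γ * ⨆ m, z m := by
    rw [(isNormal_mul_right hpos).map_iSup bddAbove_of_small]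
    exact congrArg _ (funext hz)
  rw [hsup, opow_add_one]
  refine mul_dvd_mul_left _ (isSuccPrelimit_iff_omega0_dvd.1
    (isSuccPrelimit_of_succ_lt fun a ha => ?_))
  obtain ⟨m, hm⟩ := exists_lt_of_lt_ciSup ha
  exact (succ_le_of_lt hm).trans_lt ((hzm m).trans_le (le_ciSup bddAbove_of_small _))

end

/-! ### Positive operators cannot be bounded below beyond the Cantor–Bendixson height -/

section
open Ordinal Order Set

lemma isClopen_setOf_ioc (o a b : Ordinal) :
    IsClopen {x : OrdinalInterval o | a < x ∧ (x : Ordinal) ≤ b} := by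
  have h1 : {x : OrdinalInterval o | a < x ∧ (x : Ordinal) ≤ b} =
      Subtype.val ⁻¹' Icc (succ a) b := by ext x; simp
  have h2 : {x : OrdinalInterval o | a < x ∧ (x : Ordinal) ≤ b} =
      Subtype.val ⁻¹' Ioo a (succ b) := by ext x; simp
  exact ⟨h1 ▸ isClosed_Icc.preimage continuous_subtype_val,
    h2 ▸ isOpen_Ioo.preimage continuous_subtype_val⟩

/-- The indicator function of the clopen interval `(a, b]` in `[0, o]`. -/
noncomputable def iocIndicator (o a b : Ordinal) : C(OrdinalInterval o, ℝ) :=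
  LocallyConstant.charFn ℝ (isClopen_setOf_ioc o a b)

variable {o a b : Ordinal}

lemma iocIndicator_of_mem {x : OrdinalInterval o} (h : a < x ∧ (x : Ordinal) ≤ b) :
    iocIndicator o a b x = 1 :=
  (LocallyConstant.charFn_eq_one ℝ x (isClopen_setOf_ioc o a b)).2 h

lemma iocIndicator_of_notMem {x : OrdinalInterval o} (h : ¬ (a < x ∧ (x : Ordinal) ≤ b)) :
    iocIndicator o a b x = 0 :=
  (LocallyConstant.charFn_eq_zero ℝ x (isClopen_setOf_ioc o a b)).2 h

lemma iocIndicator_nonneg : 0 ≤ iocIndicator o a b := by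
  intro x
  by_cases h : a < x ∧ (x : Ordinal) ≤ b
  · exact zero_le_one.trans (iocIndicator_of_mem h).ge
  · exact (iocIndicator_of_notMem h).ge

lemma iocIndicator_mono {a' b' : Ordinal} (ha : a' ≤ a) (hb : b ≤ b') :
    iocIndicator o a b ≤ iocIndicator o a' b' := by
  intro x
  by_cases h : a < x ∧ (x : Ordinal) ≤ b
  · exact ((iocIndicator_of_mem h).trans
      (iocIndicator_of_mem ⟨ha.trans_lt h.1, h.2.trans hb⟩).symm).le
  · exact (iocIndicator_of_notMem h).trans_le (iocIndicator_nonneg x)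

lemma sum_iocIndicator_le_one {ι : Type*} (s : Finset ι) (a b : ι → Ordinal)
    (h : ∀ i j x, a i < x → x ≤ b i → a j < x → x ≤ b j → i = j) :
    ∑ i ∈ s, iocIndicator o (a i) (b i) ≤ 1 := by
  intro x
  change (∑ i ∈ s, iocIndicator o (a i) (b i)) x ≤ 1
  rw [ContinuousMap.sum_apply]
  by_cases hx : ∃ i ∈ s, a i < x ∧ (x : Ordinal) ≤ b i
  · obtain ⟨i, hi, hxi⟩ := hx
    rw [Finset.sum_eq_single i, iocIndicator_of_mem hxi]
    · intro j _ hj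
      exact iocIndicator_of_notMem fun hxj => hj (h j i x hxj.1 hxj.2 hxi.1 hxi.2)
    · exact fun h => absurd hi h
  · push Not at hx
    rw [Finset.sum_eq_zero fun i hi => iocIndicator_of_notMem fun hh => (hx i hi hh.1).not_ge hh.2]
    exact zero_le_one

/-- The closed set of ordinals `y ≤ β` at which `f` is at least `ε`. -/
def superlevel {l : Ordinal} (f : C(OrdinalInterval l, ℝ)) (β : Ordinal) (ε : ℝ) : Set Ordinal :=
  Subtype.val '' {y : OrdinalInterval l | (y : Ordinal) ≤ β ∧ ε ≤ f y}

lemma isCompact_superlevel {l : Ordinal} (f : C(OrdinalInterval l, ℝ)) (β : Ordinal) (ε : ℝ) :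
    IsCompact (superlevel f β ε) :=
  ((isClosed_Iic.preimage continuous_subtype_val).inter
    (isClosed_le continuous_const f.continuous)).isCompact.image continuous_subtype_val

lemma superlevel_mono {l β : Ordinal} {f g : C(OrdinalInterval l, ℝ)} {ε : ℝ} (h : f ≤ g) :
    superlevel f β ε ⊆ superlevel g β ε :=
  image_mono fun y hy => ⟨hy.1, hy.2.trans (h y)⟩

/-- Suppose `T ≥ 0` maps the indicators of all subintervals of `U = (a₀, b₀]` to functions that
reach `ε` on `[0, β]`. Then they reach `ε` at a point that is at least as high in the
Cantor–Bendixson hierarchy as the points of the subinterval. -/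
lemma exists_omega0_opow_dvd_mem_superlevel {k l β a₀ b₀ : Ordinal}
    (T : C(OrdinalInterval k, ℝ) →ₗ[ℝ] C(OrdinalInterval l, ℝ)) (hT : ∀ f, 0 ≤ f → 0 ≤ T f)
    {ε : ℝ} (hε : 0 < ε)
    (H : ∀ a b, a₀ ≤ a → a < b → b ≤ b₀ → (superlevel (T (iocIndicator k a b)) β ε).Nonempty)
    (γ : Ordinal) : ∀ a b, a₀ ≤ a → a < b → b ≤ b₀ → ω ^ γ ∣ b →
      ∃ y ∈ superlevel (T (iocIndicator k a b)) β ε, ω ^ γ ∣ y ∧ (0 < γ → 0 < y) := by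
  have hmono : ∀ f g, f ≤ g → T f ≤ T g := fun f g h => by
    have := hT (g - f) (sub_nonneg.2 h)
    rwa [map_sub, sub_nonneg] at this
  induction γ using Ordinal.limitRecOn with
  | zero =>
    intro a b ha hab hb _
    obtain ⟨y, hy⟩ := H a b ha hab hb
    exact ⟨y, hy, by simp, fun h => absurd h (lt_irrefl _)⟩
  | add_one γ ih =>
    intro a b ha hab hb hdvd
    -- `(a, b]` contains the disjoint intervals `(z k, z (k + 1)]` ending at multiples of `ω ^ γ`
    have hpos : 0 < ω ^ γ := opow_pos γ omega0_pos
    obtain ⟨q, rfl⟩ := hdvd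
    have hassoc : ω ^ (γ + 1) * q = ω ^ γ * (ω * q) := by rw [opow_add_one, mul_assoc]
    have hq : IsSuccLimit (ω * q) := by
      refine ⟨fun h0 => ?_, isSuccPrelimit_iff_omega0_dvd.2 (dvd_mul_right _ _)⟩
      rw [hassoc, h0.eq_bot, bot_eq_zero, mul_zero] at hab
      exact not_lt_zero hab
    rw [hassoc] at hab hb ⊢
    obtain ⟨c, hc, hac⟩ := (lt_mul_iff_of_isSuccLimit hq).1 hab
    have hck : ∀ n : ℕ, c + n < ω * q := by
      intro n
      induction n with
      | zero => simpa using hc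
      | succ n ih => rw [Nat.cast_succ, ← add_assoc]; exact hq.succ_lt ih
    let z : ℕ → Ordinal := fun n => ω ^ γ * (c + n)
    have hz : StrictMono z := fun m n h => by
      refine (mul_lt_mul_iff_right₀ hpos).2 ?_
      gcongr
    have haz : ∀ n, a ≤ z n := fun n =>
      (hac.trans_le ((mul_le_mul_iff_right₀ hpos).2 le_self_add)).le
    have hzb : ∀ n, z n ≤ ω ^ γ * (ω * q) := fun n => (mul_le_mul_iff_right₀ hpos).2 (hck n).le
    have hex := fun n => ih (z n) (z (n + 1)) (ha.trans (haz n)) (hz (Nat.lt_succ_self n))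
      ((hzb _).trans hb) (dvd_mul_right _ _)
    choose y hy hyd _ using hex
    obtain ⟨g, hg | hg⟩ := exists_increasing_or_nonincreasing_subseq (· < ·) y
    · have hgm : StrictMono fun m => y (g m) := fun m n h => hg m n h
      refine ⟨⨆ m, y (g m), ?_, omega0_opow_add_one_dvd_iSup hgm fun m => hyd _, fun _ => ?_⟩
      · refine (isCompact_superlevel _ _ _).isClosed.closure_subset_iff.2 ?_
          (csSup_mem_closure (range_nonempty _) bddAbove_of_small)
        rintro _ ⟨m, rfl⟩
        exact superlevel_mono (hmono _ _ (iocIndicator_mono (haz _) (hzb _))) (hy (g m))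
      · exact (zero_le.trans_lt (hgm Nat.zero_lt_one)).trans_le
          (le_ciSup (f := fun m => y (g m)) bddAbove_of_small 1)
    · -- otherwise some point `p` is among the `y k` infinitely often, making `T 1 p` infinite
      exfalso
      obtain ⟨M, hM⟩ := csInf_mem (range_nonempty fun m => y (g m))
      have hconst : ∀ m, y (g (M + m)) = y (g M) := by
        intro m
        rcases m.eq_zero_or_pos with rfl | hm
        · rfl
        · refine le_antisymm (not_lt.1 (hg _ _ (Nat.lt_add_of_pos_right hm))) ?_
          change (fun m => y (g m)) M ≤ _
          rw [hM]
          exact csInf_le (OrderBot.bddBelow _) ⟨_, rfl⟩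
      obtain ⟨p, -, hp⟩ := hy (g M)
      have hle : ∀ m, ε ≤ T (iocIndicator k (z (g (M + m))) (z (g (M + m) + 1))) p := by
        intro m
        obtain ⟨p', hp', hpp'⟩ := hy (g (M + m))
        rw [hconst, ← hp] at hpp'
        rw [← Subtype.ext hpp']
        exact hp'.2
      obtain ⟨N, hN⟩ := exists_nat_gt (T 1 p / ε)
      rw [div_lt_iff₀ hε] at hN
      have hsum := hmono _ _ (sum_iocIndicator_le_one (o := k) (Finset.range N)
        (fun m => z (g (M + m))) (fun m => z (g (M + m) + 1)) (by
          have key : ∀ i j x, i < j → x ≤ z (g (M + i) + 1) → ¬ z (g (M + j)) < x := by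
            intro i j x hij hx hx'
            have h1 : g (M + i) < g (M + j) := g.strictMono (by omega)
            exact (hx.trans (hz.monotone h1)).not_gt hx'
          intro i j x hi hi' hj hj'
          rcases lt_trichotomy i j with h | h | h
          · exact absurd hj (key i j x h hi')
          · exact h
          · exact absurd hi (key j i x h hj'))) p
      rw [map_sum] at hsum
      have h2 : (∑ m ∈ Finset.range N, T (iocIndicator k (z (g (M + m))) (z (g (M + m) + 1)))) p
          ≤ T 1 p := hsum
      rw [ContinuousMap.sum_apply] at h2
      have h3 := Finset.card_nsmul_le_sum (Finset.range N) _ ε fun m _ => hle m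
      rw [Finset.card_range, _root_.nsmul_eq_mul] at h3
      linarith
  | limit γ hγ ih =>
    intro a b ha hab hb hdvd
    let ι := {δ : Ordinal // 0 < δ ∧ δ < γ}
    let t : ι → Set Ordinal := fun δ =>
      superlevel (T (iocIndicator k a b)) β ε ∩ ({y | ω ^ (δ : Ordinal) ∣ y} ∩ Ici 1)
    have : Nonempty ι := ⟨⟨1, zero_lt_one, one_lt_of_isSuccLimit hγ⟩⟩
    have hcl : ∀ δ : ι, IsClosed ({y | ω ^ (δ : Ordinal) ∣ y} ∩ Ici (1 : Ordinal)) := fun δ =>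
      (isClosed_setOf_omega0_opow_dvd _).inter isClosed_Ici
    obtain ⟨y, hy⟩ := IsCompact.nonempty_iInter_of_directed_nonempty_isCompact_isClosed t
      (by
        intro δ δ'
        refine ⟨⟨max δ δ', lt_max_of_lt_left δ.2.1, max_lt δ.2.2 δ'.2.2⟩, ?_, ?_⟩
        · exact fun y hy => ⟨hy.1, (opow_dvd_opow _ (le_max_left _ _)).trans hy.2.1, hy.2.2⟩
        · exact fun y hy => ⟨hy.1, (opow_dvd_opow _ (le_max_right _ _)).trans hy.2.1, hy.2.2⟩)
      (by
        intro δ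
        obtain ⟨y, hy, hyd, hy0⟩ := ih δ δ.2.2 a b ha hab hb
          ((opow_dvd_opow _ δ.2.2.le).trans hdvd)
        exact ⟨y, hy, hyd, one_le_iff_pos.2 (hy0 δ.2.1)⟩)
      (fun δ => (isCompact_superlevel _ _ _).inter_right (hcl δ))
      (fun δ => (isCompact_superlevel _ _ _).isClosed.inter (hcl δ))
    rw [mem_iInter] at hy
    refine ⟨y, (hy (Classical.arbitrary ι)).1, ?_, fun _ =>
      one_le_iff_pos.1 (hy (Classical.arbitrary ι)).2.2⟩
    exact omega0_opow_dvd_of_isSuccLimit hγ fun δ h0 h1 => (hy ⟨δ, h0, h1⟩).2.1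

/-- Near a point divisible by `ω ^ α` there is an interval whose indicator is mapped by `T ≥ 0` to
a function that is small on `[0, β]`, `β < ω ^ α`. -/
lemma exists_iocIndicator_lt {k l α β a₀ b₀ : Ordinal}
    (T : C(OrdinalInterval k, ℝ) →ₗ[ℝ] C(OrdinalInterval l, ℝ)) (hT : ∀ f, 0 ≤ f → 0 ≤ T f)
    {ε : ℝ} (hε : 0 < ε) (hα : α ≠ 0) (hβ : β < ω ^ α) (hab : a₀ < b₀) (hb : ω ^ α ∣ b₀) :
    ∃ a b, a₀ ≤ a ∧ a < b ∧ b ≤ b₀ ∧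
      ∀ y : OrdinalInterval l, (y : Ordinal) ≤ β → T (iocIndicator k a b) y < ε := by
  by_contra! hcon
  obtain ⟨_, ⟨y, hy, rfl⟩, hyd, hy0⟩ := exists_omega0_opow_dvd_mem_superlevel T hT hε
    (fun a b h1 h2 h3 => by
      obtain ⟨y, hy, h⟩ := hcon a b h1 h2 h3
      exact ⟨y, y, ⟨hy, h⟩, rfl⟩) α a₀ b₀ le_rfl hab le_rfl hb
  exact (hy.1.trans_lt hβ).not_ge (le_of_dvd (hy0 (pos_iff_ne_zero.2 hα)).ne' hyd)

end

/-! ### The lower bound -/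

section
open Ordinal Order Set

instance (o : Ordinal) : Nonempty (OrdinalInterval o) := ⟨⟨0, le_rfl, zero_le⟩⟩

lemma exists_ioc_abs_sub_lt {o : Ordinal} (f : C(OrdinalInterval o, ℝ)) (x : OrdinalInterval o)
    (hx : 0 < (x : Ordinal)) {η : ℝ} (hη : 0 < η) :
    ∃ a < (x : Ordinal), ∀ y : OrdinalInterval o, a < y → (y : Ordinal) ≤ x →
      |f y - f x| < η := by
  have hU : {y | |f y - f x| < η} ∈ nhds x := by
    refine IsOpen.mem_nhds (isOpen_lt (by fun_prop) continuous_const) ?_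
    simpa using hη
  obtain ⟨a, ha, hs⟩ := exists_Ioc_subset_of_mem_nhds hU ⟨⟨0, le_rfl, zero_le⟩, hx⟩
  exact ⟨a, ha, fun y h1 h2 => hs ⟨h1, h2⟩⟩

/-- One point of the top Cantor–Bendixson level: if `T ≥ 0` gives the mass `m` to a neighbourhood
of it, `h = T⁻¹ 1`, then a narrow bump `g` with `T g ≤ m + η` turns into the test function
`2 / (m + η) * g - h`, which has large norm but is mapped into the unit ball. -/
lemma two_le_mul_add {k α a₀ b₀ : Ordinal}
    (T : C(OrdinalInterval k, ℝ) ≃L[ℝ] C(OrdinalInterval (ω ^ α), ℝ)) (hT : IsPositiveIso T)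
    (hα : α ≠ 0) (hab : a₀ < b₀) (hbk : b₀ ≤ k) (hb : ω ^ α ∣ b₀) {η c : ℝ} (hη : 0 < η)
    (hc : ∀ x : OrdinalInterval k, a₀ < x → (x : Ordinal) ≤ b₀ → T.symm 1 x ≤ c) :
    2 ≤ (‖(T.symm : C(OrdinalInterval (ω ^ α), ℝ) →L[ℝ] C(OrdinalInterval k, ℝ))‖ + c) *
      (T (iocIndicator k a₀ b₀) ⟨ω ^ α, zero_le, le_rfl⟩ + η) := by
  set y₀ : OrdinalInterval (ω ^ α) := ⟨ω ^ α, zero_le, le_rfl⟩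
  set m := T (iocIndicator k a₀ b₀) y₀
  have hm : 0 ≤ m := hT _ iocIndicator_nonneg y₀
  have hmη : 0 < m + η := by linarith
  obtain ⟨β, hβ, hβ'⟩ := exists_ioc_abs_sub_lt (T (iocIndicator k a₀ b₀)) y₀
    (opow_pos α omega0_pos) hη
  obtain ⟨a, b, ha, hab', hb', hsmall⟩ := exists_iocIndicator_lt
    (T : C(OrdinalInterval k, ℝ) →ₗ[ℝ] C(OrdinalInterval (ω ^ α), ℝ)) hT hη hα hβ hab hb
  set g := iocIndicator k a b
  have hg0 : ∀ y, 0 ≤ T g y := hT _ iocIndicator_nonneg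
  have hg1 : ∀ y, T g y ≤ m + η := by
    intro y
    rcases le_or_gt (y : Ordinal) β with hy | hy
    · have : T g y < η := hsmall y hy
      linarith
    · have h1 : T g y ≤ T (iocIndicator k a₀ b₀) y := by
        have := hT _ (sub_nonneg.2 (iocIndicator_mono (o := k) ha hb')) y
        rw [map_sub] at this
        exact sub_nonneg.1 this
      have h2 := (abs_lt.1 (hβ' y hy y.2.2)).2
      linarith
  let f := (2 / (m + η)) • g - T.symm 1
  have hTf : T f = (2 / (m + η)) • T g - 1 := by
    simp only [f, map_sub, map_smul, T.apply_symm_apply]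
  have hTf1 : ‖T f‖ ≤ 1 := by
    rw [ContinuousMap.norm_le _ zero_le_one]
    intro y
    rw [hTf]
    change |2 / (m + η) * T g y - 1| ≤ 1
    have h1 : 0 ≤ 2 / (m + η) * T g y := mul_nonneg (by positivity) (hg0 y)
    have h2 : 2 / (m + η) * T g y ≤ 2 := by
      rw [div_mul_eq_mul_div, div_le_iff₀ hmη]
      linarith [hg1 y]
    rw [abs_le]
    constructor <;> linarith
  have hf := (T.symm : C(OrdinalInterval (ω ^ α), ℝ) →L[ℝ] C(OrdinalInterval k, ℝ)).le_of_opNorm_le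
    le_rfl (T f)
  have hf' : ‖f‖ ≤ ‖(T.symm : C(OrdinalInterval (ω ^ α), ℝ) →L[ℝ] C(OrdinalInterval k, ℝ))‖ := by
    have e : (T.symm : C(OrdinalInterval (ω ^ α), ℝ) →L[ℝ] C(OrdinalInterval k, ℝ)) (T f) = f :=
      T.symm_apply_apply f
    rw [e] at hf
    exact hf.trans (mul_le_of_le_one_right (norm_nonneg _) hTf1)
  let x : OrdinalInterval k := ⟨b, zero_le, hb'.trans hbk⟩
  have hx : f x = 2 / (m + η) - T.symm 1 x := by
    change 2 / (m + η) * g x - _ = _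
    rw [show g x = 1 from iocIndicator_of_mem ⟨hab', le_rfl⟩, mul_one]
  have h1 := (le_abs_self _).trans ((f.norm_coe_le_norm x).trans hf')
  have h2 := hc x (ha.trans_lt hab') hb'
  rw [hx] at h1
  rw [← div_le_iff₀ hmη]
  linarith

lemma two_mul_sub_one_le_of_isPositiveIso {α : Ordinal} (hα : α ≠ 0) (n : ℕ)
    (T : C(OrdinalInterval (ω ^ α * n), ℝ) ≃L[ℝ] C(OrdinalInterval (ω ^ α), ℝ))
    (hT : IsPositiveIso T) :
    2 * (n : ℝ) - 1 ≤ ‖(T : C(OrdinalInterval (ω ^ α * n), ℝ) →L[ℝ]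
        C(OrdinalInterval (ω ^ α), ℝ))‖ *
      ‖(T.symm : C(OrdinalInterval (ω ^ α), ℝ) →L[ℝ] C(OrdinalInterval (ω ^ α * n), ℝ))‖ := by
  set t := ‖(T : C(OrdinalInterval (ω ^ α * n), ℝ) →L[ℝ] C(OrdinalInterval (ω ^ α), ℝ))‖
  set s := ‖(T.symm : C(OrdinalInterval (ω ^ α), ℝ) →L[ℝ] C(OrdinalInterval (ω ^ α * n), ℝ))‖
  have hs0 : 0 ≤ s := by positivity
  have hpos : 0 < ω ^ α := opow_pos α omega0_pos
  let y₀ : OrdinalInterval (ω ^ α) := ⟨ω ^ α, zero_le, le_rfl⟩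
  let h := T.symm 1
  have hTh : T h = 1 := T.apply_symm_apply 1
  have hh : ∀ x, |h x| ≤ s := by
    intro x
    refine (h.norm_coe_le_norm x).trans (((T.symm : C(OrdinalInterval (ω ^ α), ℝ) →L[ℝ]
      C(OrdinalInterval (ω ^ α * n), ℝ)).le_opNorm 1).trans ?_)
    rw [norm_one, mul_one]
  let x : Fin n → OrdinalInterval (ω ^ α * n) := fun i =>
    ⟨ω ^ α * ((i : ℕ) + 1 : ℕ), zero_le, by
      gcongr
      exact i.2⟩
  have hmono : ∀ f g, f ≤ g → T f y₀ ≤ T g y₀ := fun f g hfg => by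
    have := hT (g - f) (sub_nonneg.2 hfg) y₀
    rw [map_sub] at this
    exact sub_nonneg.1 this
  have hT1 : T 1 y₀ ≤ t := by
    refine (le_abs_self _).trans (((T 1).norm_coe_le_norm y₀).trans
      (((T : C(OrdinalInterval (ω ^ α * n), ℝ) →L[ℝ]
        C(OrdinalInterval (ω ^ α), ℝ)).le_opNorm 1).trans ?_))
    rw [norm_one, mul_one]
  -- the estimate up to an error that vanishes with `η`
  have key : ∀ η : ℝ, 0 < η → 2 * (n : ℝ) - n * (η * (2 * s + η + 2 * t)) ≤ 1 + t * s := by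
    intro η hη
    have hnear : ∀ i : Fin n, ∃ a, ω ^ α * (i : ℕ) ≤ a ∧ a < x i ∧
        ∀ y : OrdinalInterval (ω ^ α * n), a < y → (y : Ordinal) ≤ x i →
          |h y - h (x i)| < η := by
      intro i
      have hlt : ω ^ α * (i : ℕ) < x i :=
        (mul_lt_mul_iff_right₀ hpos).2 (by exact_mod_cast Nat.lt_succ_self _)
      obtain ⟨a, ha, hay⟩ := exists_ioc_abs_sub_lt h (x i) (zero_le.trans_lt hlt) hη
      exact ⟨max a (ω ^ α * (i : ℕ)), le_max_right _ _, max_lt ha hlt,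
        fun y hy => hay y ((le_max_left _ _).trans_lt hy)⟩
    choose a hia hax hay using hnear
    let m : Fin n → ℝ := fun i => T (iocIndicator _ (a i) (x i)) y₀
    have hdisj : ∀ i j (y : Ordinal), a i < y → y ≤ x i → a j < y → y ≤ x j → i = j := by
      have aux : ∀ i j (y : Ordinal), i < j → y ≤ x i → ¬ a j < y := by
        intro i j y hij hy hy'
        refine (hy.trans (le_trans ?_ (hia j))).not_gt hy'
        refine (mul_le_mul_iff_right₀ hpos).2 ?_
        exact_mod_cast Nat.succ_le_of_lt hij
      intro i j y h1 h2 h3 h4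
      rcases lt_trichotomy i j with hij | hij | hij
      · exact absurd h3 (aux i j y hij h2)
      · exact hij
      · exact absurd h1 (aux j i y hij h4)
    have hm0 : ∀ i, 0 ≤ m i := fun i => hT _ iocIndicator_nonneg y₀
    have hmt : ∀ i, m i ≤ t := by
      intro i
      refine (hmono _ 1 ?_).trans hT1
      simpa using sum_iocIndicator_le_one (o := ω ^ α * n) {i} a (fun j => (x j : Ordinal)) hdisj
    have hle : ∑ i, (s + h (x i) - η) • iocIndicator (ω ^ α * n) (a i) (x i) ≤
        h + s • (1 : C(OrdinalInterval (ω ^ α * n), ℝ)) := by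
      intro y
      change (∑ i, (s + h (x i) - η) • iocIndicator (ω ^ α * n) (a i) (x i)) y ≤ h y + s * 1
      rw [ContinuousMap.sum_apply]
      by_cases hy : ∃ i, a i < y ∧ (y : Ordinal) ≤ x i
      · obtain ⟨i, hi⟩ := hy
        rw [Finset.sum_eq_single i, ContinuousMap.smul_apply, iocIndicator_of_mem hi, _root_.smul_eq_mul]
        · have := (abs_lt.1 (hay i y hi.1 hi.2)).1
          linarith
        · intro j _ hj
          rw [ContinuousMap.smul_apply, iocIndicator_of_notMem, smul_zero]
          exact fun hj' => hj (hdisj j i y hj'.1 hj'.2 hi.1 hi.2)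
        · simp
      · push Not at hy
        rw [Finset.sum_eq_zero]
        · linarith [(abs_le.1 (hh y)).1]
        · intro i _
          rw [ContinuousMap.smul_apply, iocIndicator_of_notMem, smul_zero]
          exact fun hi => (hy i hi.1).not_ge hi.2
    have hsum := hmono _ _ hle
    rw [map_sum, map_add, hTh, map_smul, ContinuousMap.sum_apply] at hsum
    have hsum' : ∑ i, (s + h (x i) - η) * m i ≤ 1 + s * T 1 y₀ := by
      refine le_of_eq_of_le (Finset.sum_congr rfl fun i _ => ?_) hsum
      rw [map_smul]
      rfl
    have hterm : ∀ i, 2 - η * (2 * s + η + 2 * t) ≤ (s + h (x i) - η) * m i := by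
      intro i
      have h2 := two_le_mul_add T hT hα (hax i) (x i).2.2 (dvd_mul_right _ _) hη
        (c := h (x i) + η) (fun y h1 h2 => by
          have := (abs_lt.1 (hay i y h1 h2)).2
          change h y ≤ _
          linarith)
      change 2 ≤ (s + (h (x i) + η)) * (m i + η) at h2
      have h3 := mul_le_mul_of_nonneg_left (le_of_abs_le (hh (x i))) hη.le
      have h4 := mul_le_mul_of_nonneg_left (hmt i) hη.le
      nlinarith
    have h5 := Finset.card_nsmul_le_sum Finset.univ _ _ fun i _ => hterm i
    rw [Finset.card_univ, Fintype.card_fin, _root_.nsmul_eq_mul] at h5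
    have h6 := mul_le_mul_of_nonneg_left hT1 hs0
    linarith
  have hlim : Filter.Tendsto (fun η : ℝ => 2 * (n : ℝ) - n * (η * (2 * s + η + 2 * t)))
      (nhdsWithin 0 (Ioi 0)) (nhds (2 * (n : ℝ))) := by
    refine Filter.Tendsto.mono_left (Continuous.tendsto' (by fun_prop) _ _ ?_) nhdsWithin_le_nhds
    simp
  have := le_of_tendsto hlim (Filter.eventually_of_mem self_mem_nhdsWithin key)
  linarith

lemma natCard_ordinalInterval_natCast.{u} (n : ℕ) :
    Finite (OrdinalInterval (n : Ordinal.{u})) ∧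
      Nat.card (OrdinalInterval (n : Ordinal.{u})) = n + 1 := by
  let e : Fin (n + 1) → OrdinalInterval (n : Ordinal.{u}) := fun i =>
    ⟨((i : ℕ) : Ordinal), zero_le, by exact_mod_cast Nat.lt_succ_iff.1 i.2⟩
  have he : Function.Bijective e := by
    constructor
    · intro i j hij
      have : ((i : ℕ) : Ordinal) = (j : ℕ) := congrArg Subtype.val hij
      exact Fin.ext (by exact_mod_cast this)
    · rintro ⟨y, hy0, hy⟩
      obtain ⟨k, rfl⟩ := lt_omega0.1 (hy.trans_lt (natCast_lt_omega0 n))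
      exact ⟨⟨k, Nat.lt_succ_iff.2 (by exact_mod_cast hy)⟩, rfl⟩
  have hf := Finite.of_surjective e he.2
  exact ⟨hf, by rw [← Nat.card_eq_of_bijective e he, Nat.card_fin]⟩

lemma natCard_eq_of_continuousLinearEquiv {K L : Type*} [TopologicalSpace K] [T1Space K] [Finite K]
    [TopologicalSpace L] [T1Space L] [Finite L] (T : C(K, ℝ) ≃L[ℝ] C(L, ℝ)) :
    Nat.card K = Nat.card L := by
  have := Fintype.ofFinite K
  have := Fintype.ofFinite L
  let eK : C(K, ℝ) ≃ₗ[ℝ] (K → ℝ) :=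
    { ContinuousMap.equivFnOfDiscrete with
        map_add' := fun _ _ => rfl
        map_smul' := fun _ _ => rfl }
  let eL : C(L, ℝ) ≃ₗ[ℝ] (L → ℝ) :=
    { ContinuousMap.equivFnOfDiscrete with
        map_add' := fun _ _ => rfl
        map_smul' := fun _ _ => rfl }
  have h := ((eK.symm.trans T.toLinearEquiv).trans eL).finrank_eq
  rw [Module.finrank_fintype_fun_eq_card, Module.finrank_fintype_fun_eq_card] at h
  rw [Nat.card_eq_fintype_card, Nat.card_eq_fintype_card, h]

theorem two_mul_sub_one_le_positiveBanachMazurDist (α : Ordinal) (n : ℕ) :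
    ENNReal.ofReal (2 * (n : ℝ) - 1) ≤
      positiveBanachMazurDist (OrdinalInterval (ω ^ α * n)) (OrdinalInterval (ω ^ α)) := by
  refine le_iInf₂ fun T hT => ENNReal.ofReal_le_ofReal ?_
  rcases eq_or_ne α 0 with rfl | hα
  · -- the spaces have dimensions `n + 1` and `2`
    have hn : n = 1 := by
      have e1 : ω ^ (0 : Ordinal) * n = (n : ℕ) := by rw [opow_zero, one_mul]
      have e2 : ω ^ (0 : Ordinal) = (1 : ℕ) := by rw [opow_zero, Nat.cast_one]
      obtain ⟨hf1, hc1⟩ := natCard_ordinalInterval_natCast n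
      obtain ⟨hf2, hc2⟩ := natCard_ordinalInterval_natCast 1
      rw [← e1] at hf1 hc1
      rw [← e2] at hf2 hc2
      have := natCard_eq_of_continuousLinearEquiv T
      omega
    have := T.one_le_norm_mul_norm_symm
    have hn' : (n : ℝ) = 1 := by rw [hn, Nat.cast_one]
    linarith
  · exact two_mul_sub_one_le_of_isPositiveIso hα n T hT

end

/-! ### Gluing ordinal intervals -/

section
open Ordinal Order Set

/-- Concatenation of two closed ordinal intervals. -/
noncomputable def ordinalIntervalSum (a b c : Ordinal) (h : a + 1 + b = c) :
    OrdinalInterval a ⊕ OrdinalInterval b ≃ₜ OrdinalInterval c := by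
  subst h
  let f : OrdinalInterval a ⊕ OrdinalInterval b → OrdinalInterval (a + 1 + b) :=
    Sum.elim (fun x => ⟨x, zero_le, x.2.2.trans ((add_assoc a 1 b).symm ▸ le_self_add)⟩)
      (fun y => ⟨a + 1 + y, zero_le, add_le_add le_rfl y.2.2⟩)
  have hf : Function.Bijective f := by
    constructor
    · rintro (x | x) (y | y) hxy
      · have h : (f (.inl x) : Ordinal) = f (.inl y) := congrArg Subtype.val hxy
        exact congrArg _ (Subtype.ext h)
      · exfalso
        have h : (x : Ordinal) = a + 1 + y := congrArg Subtype.val hxy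
        exact ((lt_add_one a).trans_le (le_self_add.trans h.ge)).not_ge x.2.2
      · exfalso
        have h : a + 1 + (x : Ordinal) = y := congrArg Subtype.val hxy
        exact ((lt_add_one a).trans_le (le_self_add.trans h.le)).not_ge y.2.2
      · exact congrArg _ (Subtype.ext (add_left_cancel (congrArg Subtype.val hxy)))
    · rintro ⟨z, hz0, hz⟩
      rcases le_or_gt z a with hza | hza
      · exact ⟨.inl ⟨z, hz0, hza⟩, rfl⟩
      · have h : a + 1 ≤ z := add_one_le_of_lt hza
        have hsub := Ordinal.add_sub_cancel_of_le h
        exact ⟨.inr ⟨z - (a + 1), zero_le, Ordinal.sub_le.2 hz⟩, Subtype.ext hsub⟩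
  refine Continuous.homeoOfEquivCompactToT2 (f := Equiv.ofBijective f hf) ?_
  refine continuous_sumElim.2 ⟨by fun_prop, Continuous.subtype_mk ?_ _⟩
  exact (isNormal_add_right (a + 1)).continuous.comp continuous_subtype_val

/-- `[0, ω ^ α]` absorbs finitely many isolated points, placed at its beginning. -/
noncomputable def finSumOrdinalInterval {α : Ordinal} (hα : α ≠ 0) (m : ℕ) :
    Fin m ⊕ OrdinalInterval (ω ^ α) ≃ₜ OrdinalInterval (ω ^ α) := by
  have hm : ∀ k : ℕ, (k : Ordinal) < ω ^ α := fun k =>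
    (natCast_lt_omega0 k).trans_le (left_le_opow _ (pos_iff_ne_zero.2 hα))
  have hadd : (m : Ordinal) + ω ^ α = ω ^ α := add_omega0_opow (hm m)
  let f : Fin m ⊕ OrdinalInterval (ω ^ α) → OrdinalInterval (ω ^ α) :=
    Sum.elim (fun j => ⟨(j : ℕ), zero_le, (hm j).le⟩)
      (fun y => ⟨m + y, zero_le, (add_le_add le_rfl y.2.2).trans hadd.le⟩)
  have hf : Function.Bijective f := by
    constructor
    · rintro (x | x) (y | y) hxy
      · have h : ((x : ℕ) : Ordinal) = (y : ℕ) := congrArg Subtype.val hxy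
        exact congrArg _ (Fin.ext (by exact_mod_cast h))
      · exfalso
        have h : ((x : ℕ) : Ordinal) = m + y := congrArg Subtype.val hxy
        have h' : (m : Ordinal) ≤ (x : ℕ) := le_self_add.trans h.ge
        exact absurd x.2 (not_lt.2 (by exact_mod_cast h'))
      · exfalso
        have h : (m : Ordinal) + x = (y : ℕ) := congrArg Subtype.val hxy
        have h' : (m : Ordinal) ≤ (y : ℕ) := le_self_add.trans h.le
        exact absurd y.2 (not_lt.2 (by exact_mod_cast h'))
      · exact congrArg _ (Subtype.ext (add_left_cancel (congrArg Subtype.val hxy)))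
    · rintro ⟨z, hz0, hz⟩
      rcases lt_or_ge z m with hzm | hzm
      · obtain ⟨k, rfl⟩ := lt_omega0.1 (hzm.trans (natCast_lt_omega0 m))
        exact ⟨.inl ⟨k, by exact_mod_cast hzm⟩, rfl⟩
      · exact ⟨.inr ⟨z - m, zero_le, (sub_le_self _ _).trans hz⟩,
          Subtype.ext (Ordinal.add_sub_cancel_of_le hzm)⟩
  refine Continuous.homeoOfEquivCompactToT2 (f := Equiv.ofBijective f hf) ?_
  refine continuous_sumElim.2 ⟨continuous_of_discreteTopology, Continuous.subtype_mk ?_ _⟩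
  exact (isNormal_add_right (m : Ordinal)).continuous.comp continuous_subtype_val

/-- `[0, ω ^ α * (m + 1)]` consists of `m + 1` copies of `[0, ω ^ α]`, `α ≠ 0`. -/
lemma nonempty_homeomorph_ordinalInterval_mul {α : Ordinal} (hα : α ≠ 0) (m : ℕ) :
    Nonempty ((Fin m × OrdinalInterval (ω ^ α)) ⊕ OrdinalInterval (ω ^ α) ≃ₜ
      OrdinalInterval (ω ^ α * (m + 1 : ℕ))) := by
  induction m with
  | zero =>
    rw [Nat.zero_add, Nat.cast_one, mul_one]
    exact ⟨Homeomorph.emptySum _ _⟩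
  | succ m ih =>
    obtain ⟨e⟩ := ih
    let Y := OrdinalInterval (ω ^ α)
    let e₁ : Fin (m + 1) × Y ≃ₜ (Fin m × Y) ⊕ Y :=
      ((Homeomorph.ofDiscrete finSumFinEquiv.symm).prodCongr (.refl Y)).trans
        ((Homeomorph.sumProdDistrib).trans
          (Homeomorph.sumCongr (.refl _) (Homeomorph.uniqueProd (Fin 1) Y)))
    have hsum : ω ^ α * (m + 1 : ℕ) + 1 + ω ^ α = ω ^ α * (m + 1 + 1 : ℕ) := by
      rw [add_assoc, add_omega0_opow (one_lt_opow.2 ⟨one_lt_omega0, hα⟩), Nat.cast_succ (m + 1),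
        mul_add_one]
    exact ⟨((e₁.trans e).sumCongr (.refl Y)).trans (ordinalIntervalSum _ _ _ hsum)⟩

/-! ### Decomposing `[0, ω ^ α]` into a sequence of smaller intervals -/

/-- If the ordinals `γ i < ω ^ α` are cofinal in `ω ^ α`, then the intervals `[0, γ i]`, laid out
one after the other, fill up `[0, ω ^ α)`. -/
lemma exists_onePoint_sigma_homeomorph {ι : Type*} (e : ι ≃ ℕ) {α : Ordinal}
    (hα : α ≠ 0) (γ : ι → Ordinal) (hγ : ∀ i, γ i < ω ^ α)
    (hcof : ∀ β < ω ^ α, ∃ i, β ≤ γ i) :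
    ∃ h : OnePoint (Σ i, OrdinalInterval (γ i)) ≃ₜ OrdinalInterval (ω ^ α),
      h OnePoint.infty = ⟨ω ^ α, zero_le, le_rfl⟩ := by
  let d : ℕ → Ordinal := fun k => Nat.rec 0 (fun k x => x + γ (e.symm k) + 1) k
  have hd0 : d 0 = 0 := rfl
  have hds : ∀ k, d (k + 1) = d k + γ (e.symm k) + 1 := fun _ => rfl
  have h1 : (1 : Ordinal) < ω ^ α := one_lt_opow.2 ⟨one_lt_omega0, hα⟩
  have hprin := isPrincipal_add_omega0_opow α
  have hd : ∀ k, d k < ω ^ α := by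
    intro k
    induction k with
    | zero => exact zero_lt_one.trans h1
    | succ k ih => exact hprin (hprin ih (hγ _)) h1
  have hmono : Monotone d := monotone_nat_of_le_succ fun k => by
    rw [hds, add_assoc]; exact le_self_add
  have hlt : ∀ i (x : OrdinalInterval (γ i)), d (e i) + x < d (e i + 1) := by
    intro i x
    rw [hds, e.symm_apply_apply]
    exact lt_add_one_iff.2 (add_le_add le_rfl x.2.2)
  let F : (Σ i, OrdinalInterval (γ i)) → OrdinalInterval (ω ^ α) := fun z =>
    ⟨d (e z.1) + z.2, zero_le, ((hlt z.1 z.2).trans (hd (e z.1 + 1))).le⟩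
  have hcont : Continuous F := continuous_sigma fun i => Continuous.subtype_mk
    ((isNormal_add_right (d (e i))).continuous.comp continuous_subtype_val) _
  have hinj : Function.Injective F := by
    rintro ⟨i, x⟩ ⟨j, y⟩ hxy
    have h : d (e i) + (x : Ordinal) = d (e j) + y := congrArg Subtype.val hxy
    have aux : ∀ i j (x : OrdinalInterval (γ i)) (y : OrdinalInterval (γ j)),
        e i < e j → d (e i) + (x : Ordinal) ≠ d (e j) + y := fun i j x y hij h =>
      ((hlt i x).trans_le ((hmono hij).trans le_self_add)).ne h
    have hij : i = j := by
      rcases lt_trichotomy (e i) (e j) with hij | hij | hij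
      · exact absurd h (aux i j x y hij)
      · exact e.injective hij
      · exact absurd h.symm (aux j i y x hij)
    subst hij
    exact congrArg _ (Subtype.ext (add_left_cancel h))
  have hrange : ∀ i, range (fun x => F ⟨i, x⟩) =
      Subtype.val ⁻¹' (Ico (d (e i)) (d (e i + 1))) := by
    intro i
    ext ⟨y, hy0, hy⟩
    constructor
    · rintro ⟨x, hx⟩
      rw [← hx]
      exact ⟨le_self_add, hlt i x⟩
    · rintro ⟨h1, h2⟩
      rw [hds, e.symm_apply_apply] at h2
      exact ⟨⟨y - d (e i), zero_le, Ordinal.sub_le.2 (lt_add_one_iff.1 h2)⟩,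
        Subtype.ext (Ordinal.add_sub_cancel_of_le h1)⟩
  have hopen : ∀ k, IsOpen (Ico (d k) (d (k + 1))) := by
    rintro (_ | k)
    · have : Ico (d 0) (d (0 + 1)) = Iio (d 1) := by ext; simp [hd0]
      exact this ▸ isOpen_Iio
    · have : Ico (d (k + 1)) (d (k + 1 + 1)) =
          Ioo (d k + γ (e.symm k)) (d (k + 1 + 1)) := by
        ext x
        rw [mem_Ico, mem_Ioo, hds k, add_one_le_iff]
      exact this ▸ isOpen_Ioo
  have hemb : Topology.IsOpenEmbedding F := by
    refine .of_continuous_injective_isOpenMap hcont hinj (isOpenMap_sigma.2 fun i => ?_)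
    have hi : Continuous fun x => F ⟨i, x⟩ := hcont.comp continuous_sigmaMk
    have hi' : Function.Injective fun x => F ⟨i, x⟩ := hinj.comp sigma_mk_injective
    exact Topology.IsOpenEmbedding.isOpenMap ⟨(hi.isClosedEmbedding hi').isEmbedding, by
      rw [hrange]; exact (hopen _).preimage continuous_subtype_val⟩
  have hF : range F = {⟨ω ^ α, zero_le, le_rfl⟩}ᶜ := by
    ext ⟨y, hy0, hy⟩
    constructor
    · rintro ⟨z, hz⟩ htop
      have h : (F z : Ordinal) = ω ^ α := congrArg Subtype.val (hz.trans htop)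
      exact ((hlt z.1 z.2).trans (hd (e z.1 + 1))).ne h
    · intro hne
      obtain ⟨i, hi⟩ := hcof y (lt_of_le_of_ne hy fun h => hne (Subtype.ext h))
      have hex : ∃ k, y < d k := ⟨e i + 1, by
        rw [hds, e.symm_apply_apply]
        exact lt_add_one_iff.2 (hi.trans le_add_self)⟩
      classical
      obtain ⟨k, hk⟩ : ∃ k, Nat.find hex = k + 1 := Nat.exists_eq_succ_of_ne_zero fun h0 => by
        have := Nat.find_spec hex
        rw [h0, hd0] at this
        exact not_lt_zero this
      have hk1 : y < d (k + 1) := hk ▸ Nat.find_spec hex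
      have hk2 : d k ≤ y := not_lt.1 (Nat.find_min hex (by omega))
      have hmem : (⟨y, hy0, hy⟩ : OrdinalInterval (ω ^ α)) ∈
          range (fun x => F ⟨e.symm k, x⟩) := by
        rw [hrange, e.apply_symm_apply]
        exact ⟨hk2, hk1⟩
      obtain ⟨x, hx⟩ := hmem
      exact ⟨_, hx⟩
  exact ⟨OnePoint.equivOfIsEmbeddingOfRangeEq _ F hemb.isEmbedding hF, rfl⟩

end

/-! ### Wedge decompositions -/

section
open Set

variable {ι κ : Type*} [TopologicalSpace ι] [DiscreteTopology ι] {C : κ → Type*}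
  [∀ k, TopologicalSpace (C k)] [∀ k, T2Space (C k)]

/-- The map onto the summand with index `i` forgetting the index. -/
def sigmaForget (z : Σ p : ι × κ, C p.2) : Σ k, C k := ⟨z.1.2, z.2⟩

/-- The inclusion of the summands of the form `(i, k)` with `i` fixed. -/
def sigmaInclude (i : ι) (z : Σ k, C k) : Σ p : ι × κ, C p.2 := ⟨(i, z.1), z.2⟩

omit [TopologicalSpace ι] [DiscreteTopology ι] [∀ k, T2Space (C k)] in
lemma continuous_sigmaForget : Continuous (sigmaForget (ι := ι) (C := C)) :=
  continuous_sigma fun p => continuous_sigmaMk (σ := C) (i := p.2)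

omit [TopologicalSpace ι] [DiscreteTopology ι] [∀ k, T2Space (C k)] in
lemma continuous_sigmaInclude (i : ι) : Continuous (sigmaInclude (C := C) i) :=
  continuous_sigma fun k => continuous_sigmaMk (σ := fun p : ι × κ => C p.2) (i := (i, k))

omit [∀ k, T2Space (C k)] in
lemma continuous_onePoint_map_sigmaInclude (i : ι) :
    Continuous (OnePoint.map (sigmaInclude (C := C) i)) := by
  refine OnePoint.continuous_map (continuous_sigmaInclude i) ?_
  rw [Filter.hasBasis_coclosedCompact.tendsto_iff Filter.hasBasis_coclosedCompact]
  rintro s ⟨hs, hs'⟩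
  have hfst : Continuous fun z : Σ p : ι × κ, C p.2 => z.1.1 :=
    continuous_sigma fun p => continuous_const (y := p.1)
  have heq : sigmaInclude i ⁻¹' s =
      sigmaForget '' (s ∩ {z : Σ p : ι × κ, C p.2 | z.1.1 = i}) := by
    ext z
    constructor
    · exact fun hz => ⟨sigmaInclude i z, ⟨hz, rfl⟩, rfl⟩
    · rintro ⟨⟨⟨j, k⟩, x⟩, ⟨hz, rfl⟩, rfl⟩
      exact hz
  refine ⟨sigmaInclude i ⁻¹' s, ⟨hs.preimage (continuous_sigmaInclude i), ?_⟩, fun z hz => hz⟩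
  rw [heq]
  exact (hs'.inter_right ((isClosed_discrete {i}).preimage hfst)).image continuous_sigmaForget

open Classical in
/-- The map collapsing all summands whose first index is not `i` to the point at infinity. -/
noncomputable def onePointCollapse (i : ι) :
    OnePoint (Σ p : ι × κ, C p.2) → OnePoint (Σ k, C k) :=
  fun z => z.elim OnePoint.infty
    fun z => if z.1.1 = i then (sigmaForget z : OnePoint (Σ k, C k)) else OnePoint.infty

omit [TopologicalSpace ι] [DiscreteTopology ι] in
lemma continuous_onePointCollapse (i : ι) : Continuous (onePointCollapse (C := C) i) := by
  classical
  refine continuous_iff_continuousAt.2 fun z => ?_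
  induction z using OnePoint.rec with
  | infty =>
    rw [OnePoint.continuousAt_infty]
    intro s hs
    obtain ⟨hs0, t, -, ht, hts⟩ := OnePoint.tendsto_nhds_infty.1 Filter.tendsto_id s hs
    have hc := ht.image (continuous_sigmaInclude (C := C) i)
    refine ⟨_, hc.isClosed, hc, ?_⟩
    rintro ⟨⟨j, k⟩, x⟩ hz
    change (if j = i then ((⟨k, x⟩ : Σ k, C k) : OnePoint (Σ k, C k)) else OnePoint.infty) ∈ s
    split_ifs with hj
    · subst hj
      exact hts fun hmem => hz ⟨_, hmem, rfl⟩
    · exact hs0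
  | coe z =>
    rw [OnePoint.continuousAt_coe]
    refine Continuous.continuousAt (continuous_sigma fun p => ?_)
    change Continuous fun x => if p.1 = i then ((⟨p.2, x⟩ : Σ k, C k) : OnePoint (Σ k, C k))
      else OnePoint.infty
    split_ifs
    · exact OnePoint.continuous_coe.comp continuous_sigmaMk
    · exact continuous_const

/-- If `Y` is the one-point compactification both of a sequence of spaces and of `ι` many copies of
this sequence, then `Y` is a wedge sum of `ι` many copies of itself. -/
noncomputable def WedgeDecomposition.ofOnePoint [Nonempty ι] {Y : Type*} [TopologicalSpace Y]
    {b : Y}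
    (h : OnePoint (Σ k, C k) ≃ₜ Y) (h' : OnePoint (Σ p : ι × κ, C p.2) ≃ₜ Y)
    (hb : h OnePoint.infty = b) (hb' : h' OnePoint.infty = b) : WedgeDecomposition ι Y b where
  emb i := ⟨fun y => h' (OnePoint.map (sigmaInclude i) (h.symm y)),
    h'.continuous.comp ((continuous_onePoint_map_sigmaInclude i).comp h.symm.continuous)⟩
  proj i := ⟨fun y => h (onePointCollapse i (h'.symm y)),
    h.continuous.comp ((continuous_onePointCollapse i).comp h'.symm.continuous)⟩
  proj_emb i y := by
    obtain ⟨z, rfl⟩ := h.surjective y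
    simp only [ContinuousMap.coe_mk, Homeomorph.symm_apply_apply]
    induction z using OnePoint.rec with
    | infty => rfl
    | coe z => exact congrArg h (if_pos rfl)
  proj_emb_of_ne i j y hij := by
    obtain ⟨z, rfl⟩ := h.surjective y
    simp only [ContinuousMap.coe_mk, Homeomorph.symm_apply_apply]
    rw [← hb]
    induction z using OnePoint.rec with
    | infty => rfl
    | coe z => exact congrArg h (if_neg hij.symm)
  emb_base i := by
    simp only [ContinuousMap.coe_mk]
    rw [← hb, h.symm_apply_apply, hb, ← hb']
    rfl
  exists_emb l := by
    obtain ⟨z, rfl⟩ := h'.surjective l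
    induction z using OnePoint.rec with
    | infty =>
      refine ⟨Classical.arbitrary ι, h OnePoint.infty, ?_⟩
      simp only [ContinuousMap.coe_mk, Homeomorph.symm_apply_apply]
      rfl
    | coe z =>
      refine ⟨z.1.1, h (sigmaForget z : OnePoint (Σ k, C k)), ?_⟩
      simp only [ContinuousMap.coe_mk, Homeomorph.symm_apply_apply]
      rfl

end

section
open Ordinal Order Set

/-- For countable `α`, list the countably many ordinals below `ω ^ α` in a sequence. Laying out
intervals of these lengths fills `[0, ω ^ α)`, whether each is used once or `ι` many times. -/
lemma nonempty_wedgeDecomposition (ι : Type) [Countable ι] [Nonempty ι] {α : Ordinal} (hα : α ≠ 0)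
    (hc : α.card ≤ Cardinal.aleph0) :
    Nonempty (WedgeDecomposition ι (OrdinalInterval (ω ^ α)) ⟨ω ^ α, zero_le, le_rfl⟩) := by
  have hpos : 0 < ω ^ α := opow_pos α omega0_pos
  have : Countable (Iio (ω ^ α)) := by
    rw [← Cardinal.mk_le_aleph0_iff, Cardinal.mk_Iio_ordinal, Cardinal.lift_le_aleph0,
      card_omega0_opow hα]
    exact max_le le_rfl hc
  have : Nonempty (Iio (ω ^ α)) := ⟨⟨0, hpos⟩⟩
  obtain ⟨γ, hγ⟩ := exists_surjective_nat (Iio (ω ^ α))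
  let _ : TopologicalSpace ι := ⊥
  have : DiscreteTopology ι := ⟨rfl⟩
  obtain ⟨e⟩ := nonempty_equiv_of_countable (α := ι × ℕ) (β := ℕ)
  obtain ⟨h, hb⟩ := exists_onePoint_sigma_homeomorph (Equiv.refl ℕ) hα (fun k => (γ k : Ordinal))
    (fun k => (γ k).2) (fun β hβ => (hγ ⟨β, hβ⟩).imp fun k hk => by rw [hk])
  obtain ⟨h', hb'⟩ := exists_onePoint_sigma_homeomorph e hα (fun p => (γ p.2 : Ordinal))
    (fun p => (γ p.2).2) (fun β hβ => by
      obtain ⟨k, hk⟩ := hγ ⟨β, hβ⟩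
      exact ⟨(Classical.arbitrary ι, k), by rw [hk]⟩)
  exact ⟨.ofOnePoint h h' hb hb'⟩

end

/-! ### The distances between `C(ω ^ α)` and `C(ω ^ α * n)` -/

theorem mainTheorem8 (α : Ordinal) (n : ℕ) (hn : 1 ≤ n) :
    ENNReal.ofReal (2 * (n : ℝ) - 1) ≤
      positiveBanachMazurDist (OrdinalInterval (Ordinal.omega0 ^ α * n))
        (OrdinalInterval (Ordinal.omega0 ^ α)) ∧
    (α ≠ 0 → α.card ≤ Cardinal.aleph0 →
      positiveBanachMazurDist (OrdinalInterval (Ordinal.omega0 ^ α * n))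
          (OrdinalInterval (Ordinal.omega0 ^ α)) ≤
        ENNReal.ofReal ((n : ℝ) + √(((n : ℝ) - 1) * ((n : ℝ) + 3))) ∧
      banachMazurDist (OrdinalInterval (Ordinal.omega0 ^ α))
          (OrdinalInterval (Ordinal.omega0 ^ α * n)) ≤
        positiveBanachMazurDist (OrdinalInterval (Ordinal.omega0 ^ α))
          (OrdinalInterval (Ordinal.omega0 ^ α * n)) ∧
      positiveBanachMazurDist (OrdinalInterval (Ordinal.omega0 ^ α))
          (OrdinalInterval (Ordinal.omega0 ^ α * n)) ≤
        ENNReal.ofReal (2 + √5)) := by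
  refine ⟨two_mul_sub_one_le_positiveBanachMazurDist α n, fun hα hc => ?_⟩
  refine ⟨?_, banachMazurDist_le_positiveBanachMazurDist _ _, ?_⟩
  · obtain ⟨m, rfl⟩ := Nat.exists_eq_add_of_le' hn
    rcases m.eq_zero_or_pos with rfl | hm
    · -- for `n = 1` the spaces coincide
      rw [Nat.zero_add, Nat.cast_one, Nat.cast_one, mul_one]
      exact (positiveBanachMazurDist_self_le _).trans (by simp)
    · have : Nonempty (Fin m) := ⟨⟨0, hm⟩⟩
      obtain ⟨e⟩ := nonempty_homeomorph_ordinalInterval_mul hα m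
      obtain ⟨W⟩ := nonempty_wedgeDecomposition (Option (Fin m)) hα hc
      refine (positiveBanachMazurDist_le_of_homeomorph e.symm
        (finSumOrdinalInterval hα m).symm).trans ((positiveBanachMazurDist_prod_sum_le W).trans_eq ?_)
      rw [Fintype.card_fin]
      push_cast
      ring_nf
  · obtain ⟨m, rfl⟩ := Nat.exists_eq_add_of_le' hn
    obtain ⟨e⟩ := nonempty_homeomorph_ordinalInterval_mul hα m
    obtain ⟨W⟩ := nonempty_wedgeDecomposition (Option (Fin m)) hα hc
    exact (positiveBanachMazurDist_le_of_homeomorph (finSumOrdinalInterval hα m).symm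
      e.symm).trans (positiveBanachMazurDist_sum_prod_le W)
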